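/- Let $N\in\{2,3\}$, let $\Omega\subset\mathbb{R}^N$ be a bounded convex polyhedral domain, let $T>0$, and set $\mathcal K(w)=\tfrac12\|w\|_{L^\infty(\Omega)}^2$. Let $d^m,\boldsymbol d,U^m,\boldsymbol U$ be functions on $(0,T)\times\Omega$ with values in $\mathbb{R}^3$ (if $N=2$, $\mathbb{R}^2$-valued fields are included by identifying $(x_1,x_2)$ with $(x_1,x_2,0)$), let $G^m$ have values in $\mathbb{R}^{3\times N}$, and let $\tilde v^m,\tilde{\boldsymbol v}$ have values in $\mathbb{R}^N$. Assume that $\boldsymbol d$ has a weak spatial gradient $\nabla\boldsymbol d$ (with $(\nabla \boldsymbol d)_{ij}=\partial_j\boldsymbol d_i$) and that, as $m\to\infty$, \begin{align*} d^m&\to\boldsymbol d &&\text{in } L^p(0,T;L^p(\Omega;\mathbb{R}^3)) \text{ for all } 1\le p<\infty,\\ G^m&\rightharpoonup\nabla\boldsymbol d &&\text{weakly in } L^2(0,T;L^2(\Omega;\mathbb{R}^{3\times N})),\\ U^m&\rightharpoonup\boldsymbol U &&\text{weakly in } L^2(0,T;L^2(\Omega;\mathbb{R}^3)),\\ \tilde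 v^m&\to\tilde{\boldsymbol v} &&\text{in } L^\infty(0,T;L^\infty(\Omega;\mathbb{R}^N)). \end{align*} Assume further that $\sup_m\|d^m\|_{L^\infty((0,T)\times\Omega)}\le 1$ and $\sup_m\|\tilde v^m\|_{L^\infty(0,T;H^2(\Omega))}\le C$ for some constant $C>0$. Then for every $\phi\in L^\infty(0,T)$ with $\phi\ge0$ the time integrands below are integrable on $(0,T)$, and \begin{multline*} \int_0^T\phi\Big[\|\boldsymbol U\|_{L^2(\Omega)}^2-\big((\nabla\boldsymbol d)^T(\boldsymbol d\times\boldsymbol U),\tilde{\boldsymbol v}\big)_{L^2(\Omega)}+\mathcal K(\tilde{\boldsymbol v})\,\tfrac12\|\nabla\boldsymbol d\|_{L^2(\Omega)}^2\Big]\,d\tau\\ \le\liminf_{m\to\infty}\int_0^T\phi\Big[\|U^m\|_{L^2(\Omega)}^2-\big((G^m)^T(d^m\times U^m),\tilde v^m\big)_{L^2(\Omega)}+\mathcal K(\tilde v^m)\,\tfrac12\|G^m\|_{L^2(\Omega)}^2\Big]\,d\tau . \end{multline*} In particular the same inequality holds along every subsequence. -/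

import Mathlib

open MeasureTheory Filter Topology
open scoped ENNReal Matrix ContDiff

noncomputable section

namespace EricksenStress

/-- `ℝⁿ` with the Euclidean norm. -/
abbrev Vec (n : ℕ) : Type := EuclideanSpace ℝ (Fin n)

/-- Real `3 × N` matrices, stored by their entries `A (i, j)`; the Euclidean norm of the entries is
the Frobenius norm `(A : A)^{1/2}`. -/
abbrev Mat3 (N : ℕ) : Type := EuclideanSpace ℝ (Fin 3 × Fin N)

/-- A bounded convex polyhedral domain: a nonempty, bounded, open, convex set whose closure is the
convex hull of finitely many points. -/
structure IsConvexPolyhedralDomain {N : ℕ} (Ω : Set (Vec N)) : Prop where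
  nonempty : Ω.Nonempty
  isOpen : IsOpen Ω
  isBounded : Bornology.IsBounded Ω
  convex : Convex ℝ Ω
  polyhedral : ∃ s : Set (Vec N), s.Finite ∧ closure Ω = convexHull ℝ s

/-- Lebesgue measure on the space-time cylinder `(0,T) × Ω`. By Fubini, `L^p(0,T;L^p(Ω))` is `L^p` of
this measure. -/
def cylinder {N : ℕ} (T : ℝ) (Ω : Set (Vec N)) : Measure (ℝ × Vec N) :=
  (volume.restrict (Set.Ioo 0 T)).prod (volume.restrict Ω)

/-- Strong convergence `f m → g` in `L^p(μ)`. -/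
def StrongLpTendsto {α V : Type*} [MeasurableSpace α] [NormedAddCommGroup V]
    (p : ℝ≥0∞) (μ : Measure α) (f : ℕ → α → V) (g : α → V) : Prop :=
  (∀ m, MemLp (f m) p μ) ∧ MemLp g p μ ∧
    Tendsto (fun m => eLpNorm (f m - g) p μ) atTop (𝓝 0)

/-- Weak convergence `f m ⇀ g` in `L²(μ)`: convergence of the classes in the weak topology of the
Banach space `L²(μ)`. -/
def WeakL2Tendsto {α V : Type*} [MeasurableSpace α] [NormedAddCommGroup V] [NormedSpace ℝ V]
    (μ : Measure α) (f : ℕ → α → V) (g : α → V) : Prop :=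
  ∃ (hf : ∀ m, MemLp (f m) 2 μ) (hg : MemLp g 2 μ),
    Tendsto (fun m => toWeakSpace ℝ (Lp V 2 μ) ((hf m).toLp (f m))) atTop
      (𝓝 (toWeakSpace ℝ (Lp V 2 μ) (hg.toLp g)))

/-- `g` is the weak partial derivative `∂_j f` on the open set `Ω`. -/
def HasWeakPartialDeriv {N : ℕ} {V : Type*} [NormedAddCommGroup V] [NormedSpace ℝ V]
    (Ω : Set (Vec N)) (j : Fin N) (f g : Vec N → V) : Prop :=
  LocallyIntegrableOn f Ω ∧ LocallyIntegrableOn g Ω ∧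
    ∀ ψ : Vec N → ℝ, ContDiff ℝ ∞ ψ → HasCompactSupport ψ → tsupport ψ ⊆ Ω →
      ∫ x in Ω, (fderiv ℝ ψ x (EuclideanSpace.single j 1)) • f x = - ∫ x in Ω, ψ x • g x

/-- `D` is the weak gradient `∇d` of the `ℝ³`-valued field `d` on `Ω`, with entries
`(∇d)_{ij} = ∂_j d_i`. -/
def HasWeakGradient {N : ℕ} (Ω : Set (Vec N)) (d : Vec N → Vec 3) (D : Vec N → Mat3 N) : Prop :=
  ∀ j : Fin N, HasWeakPartialDeriv Ω j d (fun x => WithLp.toLp 2 (fun i => D x (i, j)))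

/-- `v ∈ H²(Ω)` and `‖v‖_{H²(Ω)} ≤ C` (for `C ≥ 0`), where `‖v‖_{H²}²` is the sum of the squared
`L²` norms of `v` and of all its weak derivatives of order one and two. -/
def H2NormLE {N : ℕ} {V : Type*} [NormedAddCommGroup V] [NormedSpace ℝ V]
    (Ω : Set (Vec N)) (v : Vec N → V) (C : ℝ) : Prop :=
  ∃ (v₁ : Fin N → Vec N → V) (v₂ : Fin N → Fin N → Vec N → V),
    MemLp v 2 (volume.restrict Ω) ∧
    (∀ i, MemLp (v₁ i) 2 (volume.restrict Ω) ∧ HasWeakPartialDeriv Ω i v (v₁ i)) ∧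
    (∀ i j, MemLp (v₂ i j) 2 (volume.restrict Ω) ∧
      HasWeakPartialDeriv Ω j (v₁ i) (v₂ i j)) ∧
    eLpNorm v 2 (volume.restrict Ω) ^ 2
      + ∑ i, eLpNorm (v₁ i) 2 (volume.restrict Ω) ^ 2
      + ∑ i, ∑ j, eLpNorm (v₂ i j) 2 (volume.restrict Ω) ^ 2 ≤ ENNReal.ofReal C ^ 2

/-- The regularity weight `𝒦(v) = ½ ‖v‖²_{L^∞(Ω)}`. -/
def regWeight {N : ℕ} (Ω : Set (Vec N)) (v : Vec N → Vec N) : ℝ :=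
  1 / 2 * (eLpNorm v ∞ (volume.restrict Ω)).toReal ^ 2

/-- The vector `Aᵀ (d × u) ∈ ℝᴺ`, for a `3 × N` matrix `A` and `d, u ∈ ℝ³`. -/
def transposeMulCross {N : ℕ} (A : Mat3 N) (d u : Vec 3) : Fin N → ℝ :=
  (Matrix.of fun i j => A (i, j))ᵀ *ᵥ (d.ofLp ⨯₃ u.ofLp)

/-- The functional
`‖U‖²_{L²(Ω)} - (Gᵀ (d × U), v)_{L²(Ω)} + 𝒦(v) ½ ‖G‖²_{L²(Ω)}` of fields on `Ω`. -/
def stressFunctional {N : ℕ} (Ω : Set (Vec N)) (d U : Vec N → Vec 3) (G : Vec N → Mat3 N)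
    (v : Vec N → Vec N) : ℝ :=
  (∫ x in Ω, ‖U x‖ ^ 2)
    - (∫ x in Ω, transposeMulCross (G x) (d x) (U x) ⬝ᵥ (v x).ofLp)
    + regWeight Ω v * (1 / 2 * ∫ x in Ω, ‖G x‖ ^ 2)

/-- The functional `stressFunctional` at time `t`, weighted by `φ(t)`, for fields on the space-time
cylinder. -/
def stressDensity {N : ℕ} (Ω : Set (Vec N)) (φ : ℝ → ℝ) (d U : ℝ × Vec N → Vec 3)
    (G : ℝ × Vec N → Mat3 N) (v : ℝ × Vec N → Vec N) (t : ℝ) : ℝ :=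
  φ t * stressFunctional Ω (fun x => d (t, x)) (fun x => U (t, x)) (fun x => G (t, x))
    (fun x => v (t, x))

end EricksenStress

end

noncomputable section

namespace EricksenStress

/-! The term `Gᵀ(d × U)·v` multiplies two weakly convergent factors, so it cannot be passed to the
limit on its own. It is controlled by the two squares around it. Where `‖d‖ ≤ 1` and `κ ≥ ½‖v‖²`,
the integrand is a nonnegative quadratic form in `(u, A)` (`stressQuad_nonneg`), hence convex and
above its tangent planes (`tangent_le_stressQuad`).

Take the form with the `m`-th coefficients and its tangent plane at the limit point `(U, ∇d)`. The
slope depends on `m` only through the coefficients, which are bounded and converge, so it converges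
strongly in `L²` by dominated convergence. Paired with the weakly convergent `(U^m, G^m)` it passes
to the limit, and Euler's identity for quadratic forms identifies the limit as the integral at `(U,
∇d)`. This is `integral_stressQuad_le_liminf`.

The form needs `κ ≥ ½‖v‖²` pointwise, while `𝒦` is an essential supremum over each time slice. The
slice lemmas supply its measurability, this domination and its convergence. Fubini then turns the
time integrals into integrals over the cylinder. -/

/-! ### Pointwise algebra of the stress density -/

/-- The cross product on `ℝ³` with its Euclidean norm. -/
def crossVec (a b : Vec 3) : Vec 3 := WithLp.toLp 2 (a.ofLp ⨯₃ b.ofLp)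

/-- The matrix-vector product `A v`. -/
def mulVec3 {N : ℕ} (A : Mat3 N) (v : Vec N) : Vec 3 :=
  WithLp.toLp 2 (fun i => ∑ j, A (i, j) * v j)

/-- The rank-one matrix `a ⊗ v`. -/
def outer {N : ℕ} (a : Vec 3) (v : Vec N) : Mat3 N := WithLp.toLp 2 (fun p => a p.1 * v p.2)

/-- The partial gradient in `u` of `stressQuad`. -/
def gradU {N : ℕ} (c : ℝ) (d : Vec 3) (v : Vec N) (u : Vec 3) (A : Mat3 N) : Vec 3 :=
  c • ((2 : ℝ) • u - crossVec (mulVec3 A v) d)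

/-- The partial gradient in `A` of `stressQuad`. -/
def gradA {N : ℕ} (c κ : ℝ) (d : Vec 3) (v : Vec N) (u : Vec 3) (A : Mat3 N) : Mat3 N :=
  c • (κ • A - outer (crossVec d u) v)

/-- The pointwise integrand of `stressDensity`, a quadratic form in `(u, A)`. -/
def stressQuad {N : ℕ} (c κ : ℝ) (d : Vec 3) (v : Vec N) (u : Vec 3) (A : Mat3 N) : ℝ :=
  c * (‖u‖ ^ 2 - transposeMulCross A d u ⬝ᵥ v.ofLp + κ * (1 / 2 * ‖A‖ ^ 2))

/-- Lagrange's identity: the squares of the two sides differ by `(a · b)²`. -/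
lemma norm_crossVec_le (a b : Vec 3) : ‖crossVec a b‖ ≤ ‖a‖ * ‖b‖ := by
  refine le_of_sq_le_sq ?_ (by positivity)
  rw [mul_pow, EuclideanSpace.norm_sq_eq, EuclideanSpace.norm_sq_eq, EuclideanSpace.norm_sq_eq]
  simp only [crossVec, cross_apply, Fin.sum_univ_three, Real.norm_eq_abs, sq_abs]
  simp
  nlinarith [sq_nonneg (a 0 * b 0 + a 1 * b 1 + a 2 * b 2)]

lemma norm_mulVec3_le {N : ℕ} (A : Mat3 N) (v : Vec N) : ‖mulVec3 A v‖ ≤ ‖A‖ * ‖v‖ := by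
  refine le_of_sq_le_sq ?_ (by positivity)
  rw [mul_pow, EuclideanSpace.norm_sq_eq, EuclideanSpace.norm_sq_eq, EuclideanSpace.norm_sq_eq]
  simp only [mulVec3, Real.norm_eq_abs, sq_abs]
  rw [Fintype.sum_prod_type, Finset.sum_mul]
  exact Finset.sum_le_sum fun i _ => Finset.sum_mul_sq_le_sq_mul_sq _ _ _

lemma norm_outer {N : ℕ} (a : Vec 3) (v : Vec N) : ‖outer a v‖ = ‖a‖ * ‖v‖ := by
  refine (pow_left_inj₀ (by positivity) (by positivity) two_ne_zero).1 ?_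
  rw [mul_pow, EuclideanSpace.norm_sq_eq, EuclideanSpace.norm_sq_eq, EuclideanSpace.norm_sq_eq]
  simp only [outer, Real.norm_eq_abs, sq_abs]
  rw [Fintype.sum_prod_type, Finset.sum_mul]
  refine Finset.sum_congr rfl fun i _ => ?_
  rw [Finset.mul_sum]
  exact Finset.sum_congr rfl fun j _ => by ring

lemma inner_crossVec {N : ℕ} (A : Mat3 N) (d u : Vec 3) (v : Vec N) :
    inner ℝ (crossVec (mulVec3 A v) d) u = transposeMulCross A d u ⬝ᵥ v.ofLp := by
  simp only [PiLp.inner_apply, crossVec, mulVec3, transposeMulCross, cross_apply, dotProduct,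
    Matrix.mulVec, Fin.sum_univ_three, Matrix.transpose_apply, Matrix.of_apply]
  simp
  simp only [Finset.sum_mul, Finset.mul_sum, ← Finset.sum_sub_distrib, ← Finset.sum_add_distrib]
  exact Finset.sum_congr rfl fun j _ => by ring

lemma inner_outer {N : ℕ} (A : Mat3 N) (d u : Vec 3) (v : Vec N) :
    inner ℝ (outer (crossVec d u) v) A = transposeMulCross A d u ⬝ᵥ v.ofLp := by
  simp only [PiLp.inner_apply, crossVec, outer, transposeMulCross, dotProduct,
    Matrix.mulVec, Matrix.transpose_apply, Matrix.of_apply, Fintype.sum_prod_type_right]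
  refine Finset.sum_congr rfl fun j _ => ?_
  rw [Finset.sum_mul]
  refine Finset.sum_congr rfl fun i _ => ?_
  simp
  ring

lemma abs_transposeMulCross_le {N : ℕ} (A : Mat3 N) (d u : Vec 3) (v : Vec N) :
    |transposeMulCross A d u ⬝ᵥ v.ofLp| ≤ ‖A‖ * ‖v‖ * ‖d‖ * ‖u‖ := by
  rw [← inner_crossVec]
  refine (abs_real_inner_le_norm _ _).trans ?_
  gcongr
  refine (norm_crossVec_le _ _).trans ?_
  gcongr
  exact norm_mulVec3_le _ _

/-- The cross term is at most `‖A‖‖v‖‖u‖`, and the weight contributes at least `¼‖v‖²‖A‖²`; what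
remains dominates `(‖u‖ - ½‖A‖‖v‖)²`. The factor `½` in `𝒦` is exactly what completes this square.
-/
lemma stressQuad_nonneg {N : ℕ} {c κ : ℝ} {d : Vec 3} {v : Vec N} (hc : 0 ≤ c) (hd : ‖d‖ ≤ 1)
    (hκ : 1 / 2 * ‖v‖ ^ 2 ≤ κ) (u : Vec 3) (A : Mat3 N) : 0 ≤ stressQuad c κ d v u A := by
  refine mul_nonneg hc ?_
  have h := (le_abs_self _).trans (abs_transposeMulCross_le A d u v)
  have h1 : ‖A‖ * ‖v‖ * ‖d‖ * ‖u‖ ≤ ‖A‖ * ‖v‖ * ‖u‖ := by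
    have : 0 ≤ ‖A‖ * ‖v‖ * ‖u‖ := by positivity
    nlinarith
  have h2 := mul_le_mul_of_nonneg_right hκ (by positivity : 0 ≤ 1 / 2 * ‖A‖ ^ 2)
  nlinarith [sq_nonneg (‖u‖ - 1 / 2 * (‖A‖ * ‖v‖))]

/-- Euler's identity for a function homogeneous of degree two. It is why the tangent plane below is
written with `u' - ½u` and `A' - ½A`, without a constant term. -/
lemma inner_gradU_add_inner_gradA {N : ℕ} (c κ : ℝ) (d : Vec 3) (v : Vec N) (u : Vec 3)
    (A : Mat3 N) :
    inner ℝ (gradU c d v u A) u + inner ℝ (gradA c κ d v u A) A = 2 * stressQuad c κ d v u A := by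
  simp only [gradU, gradA, stressQuad, inner_smul_left, inner_sub_left, inner_crossVec,
    inner_outer, real_inner_self_eq_norm_sq, RCLike.conj_to_real]
  ring

lemma crossVec_sub_left (a a' b : Vec 3) :
    crossVec (a - a') b = crossVec a b - crossVec a' b := by
  ext i; simp [crossVec]

lemma crossVec_sub_right (a b b' : Vec 3) :
    crossVec a (b - b') = crossVec a b - crossVec a b' := by
  ext i; simp [crossVec]

lemma mulVec3_sub {N : ℕ} (A A' : Mat3 N) (v : Vec N) :
    mulVec3 (A - A') v = mulVec3 A v - mulVec3 A' v := by
  ext i; simp [mulVec3, sub_mul]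

/-- A nonnegative quadratic form lies above its tangent planes. -/
lemma tangent_le_stressQuad {N : ℕ} {c κ : ℝ} {d : Vec 3} {v : Vec N} (hc : 0 ≤ c)
    (hd : ‖d‖ ≤ 1) (hκ : 1 / 2 * ‖v‖ ^ 2 ≤ κ) (u u' : Vec 3) (A A' : Mat3 N) :
    inner ℝ (gradU c d v u A) (u' - (1 / 2 : ℝ) • u)
      + inner ℝ (gradA c κ d v u A) (A' - (1 / 2 : ℝ) • A) ≤ stressQuad c κ d v u' A' := by
  have h := stressQuad_nonneg hc hd hκ (u' - u) (A' - A)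
  have h1 := inner_gradU_add_inner_gradA c κ d v (u' - u) (A' - A)
  have h2 := inner_gradU_add_inner_gradA c κ d v u' A'
  have h3 := inner_gradU_add_inner_gradA c κ d v u A
  -- Symmetry of the polar form: the mixed terms agree whether the trilinear expression is read as a
  -- pairing in `u` or in `A`.
  have h4 := inner_crossVec A d u' v
  rw [← inner_outer] at h4
  have h5 := inner_crossVec A' d u v
  rw [← inner_outer] at h5
  have h6 : outer (crossVec d (u' - u)) v = outer (crossVec d u') v - outer (crossVec d u) v := by
    ext i; simp [outer, crossVec_sub_right, sub_mul]
  have h7 := real_inner_comm u u'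
  have h8 := real_inner_comm A A'
  simp only [gradU, gradA, mulVec3_sub, crossVec_sub_left, h6, inner_smul_left, inner_sub_left,
    inner_sub_right, inner_smul_right, RCLike.conj_to_real, h4, h5, h7, h8] at h1 h2 h3 ⊢
  linarith

lemma continuous_crossVec : Continuous fun p : Vec 3 × Vec 3 => crossVec p.1 p.2 := by
  unfold crossVec
  refine (PiLp.continuous_toLp 2 _).comp (continuous_pi fun i => ?_)
  fin_cases i <;> simp [cross_apply] <;> fun_prop

lemma continuous_mulVec3 {N : ℕ} : Continuous fun p : Mat3 N × Vec N => mulVec3 p.1 p.2 := by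
  unfold mulVec3; fun_prop

lemma continuous_outer {N : ℕ} : Continuous fun p : Vec 3 × Vec N => outer p.1 p.2 := by
  unfold outer; fun_prop

lemma continuous_gradU {N : ℕ} :
    Continuous fun p : ℝ × Vec 3 × Vec N × Vec 3 × Mat3 N =>
      gradU p.1 p.2.1 p.2.2.1 p.2.2.2.1 p.2.2.2.2 := by
  unfold gradU
  have h := continuous_mulVec3 (N := N) |>.comp
    (f := fun p : ℝ × Vec 3 × Vec N × Vec 3 × Mat3 N => (p.2.2.2.2, p.2.2.1)) (by fun_prop)
  have h' := continuous_crossVec.comp (h.prodMk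
    (g := fun p : ℝ × Vec 3 × Vec N × Vec 3 × Mat3 N => p.2.1) (by fun_prop))
  exact continuous_fst.smul (Continuous.sub (by fun_prop) h')

lemma continuous_gradA {N : ℕ} :
    Continuous fun p : ℝ × ℝ × Vec 3 × Vec N × Vec 3 × Mat3 N =>
      gradA p.1 p.2.1 p.2.2.1 p.2.2.2.1 p.2.2.2.2.1 p.2.2.2.2.2 := by
  unfold gradA
  have h := continuous_crossVec.comp
    (f := fun p : ℝ × ℝ × Vec 3 × Vec N × Vec 3 × Mat3 N => (p.2.2.1, p.2.2.2.2.1)) (by fun_prop)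
  have h' := continuous_outer.comp (h.prodMk
    (g := fun p : ℝ × ℝ × Vec 3 × Vec N × Vec 3 × Mat3 N => p.2.2.2.1) (by fun_prop))
  exact continuous_fst.smul (Continuous.sub (by fun_prop) h')

/-- Uniform in the coefficients, so for fixed `u, A` in `L²` the right side is a single `L²`
majorant for all `m`. -/
lemma norm_gradU_le {N : ℕ} {c B M : ℝ} {d : Vec 3} {v : Vec N} (hc : |c| ≤ B) (hd : ‖d‖ ≤ 1)
    (hv : ‖v‖ ≤ M) (u : Vec 3) (A : Mat3 N) :
    ‖gradU c d v u A‖ ≤ B * (2 * ‖u‖ + M * ‖A‖) := by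
  have hB : 0 ≤ B := (abs_nonneg _).trans hc
  have hM : 0 ≤ M := (norm_nonneg _).trans hv
  rw [gradU, norm_smul, Real.norm_eq_abs]
  gcongr
  refine (norm_sub_le _ _).trans (add_le_add (by simp [norm_smul]) ?_)
  calc _ ≤ ‖A‖ * ‖v‖ * ‖d‖ := (norm_crossVec_le _ _).trans (by gcongr; exact norm_mulVec3_le _ _)
    _ ≤ ‖A‖ * M * 1 := by gcongr
    _ = M * ‖A‖ := by ring

lemma norm_gradA_le {N : ℕ} {c κ B M : ℝ} {d : Vec 3} {v : Vec N} (hc : |c| ≤ B) (hd : ‖d‖ ≤ 1)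
    (hv : ‖v‖ ≤ M) (hκ : |κ| ≤ M) (u : Vec 3) (A : Mat3 N) :
    ‖gradA c κ d v u A‖ ≤ B * (M * ‖A‖ + M * ‖u‖) := by
  have hB : 0 ≤ B := (abs_nonneg _).trans hc
  have hM : 0 ≤ M := (norm_nonneg _).trans hv
  rw [gradA, norm_smul, Real.norm_eq_abs]
  gcongr
  refine (norm_sub_le _ _).trans (add_le_add ?_ ?_)
  · rw [norm_smul, Real.norm_eq_abs]; gcongr
  · rw [norm_outer]
    calc _ ≤ ‖d‖ * ‖u‖ * ‖v‖ := by gcongr; exact norm_crossVec_le _ _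
      _ ≤ 1 * ‖u‖ * M := by gcongr
      _ = M * ‖u‖ := by ring

/-! ### Weak and strong convergence in `L²` -/

/-- A weakly convergent sequence tested against a strongly convergent one. -/
lemma tendsto_inner_of_tendsto_toWeakSpace {E : Type*} [NormedAddCommGroup E]
    [InnerProductSpace ℝ E] [CompleteSpace E] {x h : ℕ → E} {x₀ h₀ : E}
    (hx : Tendsto (fun m => toWeakSpace ℝ E (x m)) atTop (𝓝 (toWeakSpace ℝ E x₀)))
    (hh : Tendsto h atTop (𝓝 h₀)) :
    Tendsto (fun m => inner ℝ (h m) (x m)) atTop (𝓝 (inner ℝ h₀ x₀)) := by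
  have key : ∀ y : E, Tendsto (fun m => inner ℝ y (x m)) atTop (𝓝 (inner ℝ y x₀)) := fun y =>
    ((WeakBilin.eval_continuous (topDualPairing ℝ E).flip (innerSL ℝ y)).tendsto _).comp hx
  -- A weakly convergent sequence is norm bounded, by the uniform boundedness principle.
  obtain ⟨K, hK⟩ : ∃ K, ∀ m, ‖innerSL ℝ (x m)‖ ≤ K := by
    refine banach_steinhaus fun y => ?_
    obtain ⟨b, hb⟩ := (key y).norm.bddAbove_range
    refine ⟨b, fun m => ?_⟩
    rw [innerSL_apply_apply, real_inner_comm]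
    exact hb ⟨m, rfl⟩
  have h0 : Tendsto (fun m => inner ℝ (h m - h₀) (x m)) atTop (𝓝 0) := by
    refine squeeze_zero_norm (a := fun m => ‖h m - h₀‖ * K) (fun m => ?_) ?_
    · refine (norm_inner_le_norm _ _).trans ?_
      gcongr
      simpa using hK m
    · simpa using (tendsto_iff_norm_sub_tendsto_zero.1 hh).mul_const K
  simpa [inner_sub_left] using h0.add (key h₀)

lemma integral_inner_eq_inner_toLp {α V : Type*} [MeasurableSpace α] {μ : Measure α}
    [NormedAddCommGroup V] [InnerProductSpace ℝ V] {f g : α → V}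
    (hf : MemLp f 2 μ) (hg : MemLp g 2 μ) :
    ∫ x, inner ℝ (f x) (g x) ∂μ = inner ℝ (hf.toLp f) (hg.toLp g) := by
  rw [L2.inner_def]
  refine integral_congr_ae ?_
  filter_upwards [hf.coeFn_toLp, hg.coeFn_toLp] with x h1 h2
  rw [h1, h2]

lemma integrable_inner_of_memLp {α V : Type*} [MeasurableSpace α] {μ : Measure α}
    [NormedAddCommGroup V] [InnerProductSpace ℝ V] {f g : α → V}
    (hf : MemLp f 2 μ) (hg : MemLp g 2 μ) : Integrable (fun x => inner ℝ (f x) (g x)) μ := by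
  refine (L2.integrable_inner (𝕜 := ℝ) (hf.toLp f) (hg.toLp g)).congr ?_
  filter_upwards [hf.coeFn_toLp, hg.coeFn_toLp] with x h1 h2
  rw [h1, h2]

lemma WeakL2Tendsto.tendsto_integral_inner {α V : Type*} [MeasurableSpace α] {μ : Measure α}
    [NormedAddCommGroup V] [InnerProductSpace ℝ V] [CompleteSpace V] {f : ℕ → α → V} {g : α → V}
    (hfg : WeakL2Tendsto μ f g) {h : ℕ → α → V} {h₀ : α → V} (hh : StrongLpTendsto 2 μ h h₀) :
    Tendsto (fun m => ∫ x, inner ℝ (h m x) (f m x) ∂μ) atTop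
      (𝓝 (∫ x, inner ℝ (h₀ x) (g x) ∂μ)) := by
  obtain ⟨hf, hg, hw⟩ := hfg
  obtain ⟨h1, h2, h3⟩ := hh
  simp_rw [fun m => integral_inner_eq_inner_toLp (h1 m) (hf m)]
  rw [integral_inner_eq_inner_toLp h2 hg]
  exact tendsto_inner_of_tendsto_toWeakSpace hw
    ((Lp.tendsto_Lp_iff_tendsto_eLpNorm'' h h1 h₀ h2).2 h3)

/-- Dominated convergence in `L²`, with almost everywhere convergence of subsequences only. -/
lemma strongLpTendsto_two_of_dominated {α V : Type*} [MeasurableSpace α] {μ : Measure α}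
    [NormedAddCommGroup V] {f : ℕ → α → V} {f₀ : α → V} {g : α → ℝ}
    (hf : ∀ m, MemLp (f m) 2 μ) (hf₀ : MemLp f₀ 2 μ) (hg : MemLp g 2 μ)
    (hb : ∀ᶠ m in atTop, ∀ᵐ x ∂μ, ‖f m x‖ ≤ g x) (hb₀ : ∀ᵐ x ∂μ, ‖f₀ x‖ ≤ g x)
    (hsub : ∀ ns : ℕ → ℕ, Tendsto ns atTop atTop → ∃ ms : ℕ → ℕ, Tendsto ms atTop atTop ∧
      ∀ᵐ x ∂μ, Tendsto (fun k => f (ns (ms k)) x) atTop (𝓝 (f₀ x))) :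
    StrongLpTendsto 2 μ f f₀ := by
  refine ⟨hf, hf₀, tendsto_of_subseq_tendsto fun ns hns => ?_⟩
  obtain ⟨ms, hms, hae⟩ := hsub ns hns
  refine ⟨ms, ?_⟩
  have key : Tendsto (fun k => ∫⁻ x, ‖(f (ns (ms k)) - f₀) x‖ₑ ^ (2 : ℝ) ∂μ) atTop
      (𝓝 (∫⁻ _, 0 ∂μ)) := by
    refine tendsto_lintegral_filter_of_dominated_convergence'
      (fun x => ‖(2 : ℝ) * g x‖ₑ ^ (2 : ℝ)) ?_ ?_ ?_ ?_
    · exact Eventually.of_forall fun k =>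
        (((hf _).1.sub hf₀.1).enorm.pow_const _)
    · filter_upwards [(hns.comp hms).eventually hb] with k hk
      filter_upwards [hk, hb₀] with x h1 h2
      gcongr
      rw [enorm_le_iff_norm_le, Pi.sub_apply]
      refine (norm_sub_le _ _).trans (le_trans ?_ (le_abs_self _))
      simp only [Function.comp_apply] at h1
      linarith
    · have := (hg.const_mul (2 : ℝ)).eLpNorm_lt_top
      rw [eLpNorm_lt_top_iff_lintegral_rpow_enorm_lt_top two_ne_zero ENNReal.ofNat_ne_top] at this
      simpa using this.ne
    · filter_upwards [hae] with x hx
      have h1 : Tendsto (fun k => ‖(f (ns (ms k)) - f₀) x‖ₑ) atTop (𝓝 0) := by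
        have := (hx.sub_const (f₀ x)).enorm
        simpa using this
      have := (ENNReal.continuous_rpow_const (y := (2 : ℝ))).continuousAt.tendsto.comp h1
      simpa [Function.comp_def] using this
  simp only [eLpNorm_eq_lintegral_rpow_enorm_toReal two_ne_zero ENNReal.ofNat_ne_top]
  have h2 := (ENNReal.continuous_rpow_const (y := 1 / (2 : ℝ))).continuousAt.tendsto.comp key
  simpa [Function.comp_def] using h2

/-! ### Essential suprema of slices -/

lemma ae_slice_ae_eq {α β V : Type*} [MeasurableSpace α] [MeasurableSpace β] {μ : Measure α}
    {ν : Measure β} [SFinite ν] {f g : α × β → V} (h : f =ᵐ[μ.prod ν] g) :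
    ∀ᵐ t ∂μ, (fun x => f (t, x)) =ᵐ[ν] fun x => g (t, x) :=
  Measure.ae_ae_of_ae_prod h

/-- The essential supremum of a slice is at most `a` exactly when the slice of `{‖f‖ > a}` is null,
and the measure of a slice depends measurably on `t`. -/
lemma measurable_eLpNorm_top_slice {α β V : Type*} [MeasurableSpace α] [MeasurableSpace β]
    {ν : Measure β} [SFinite ν] [NormedAddCommGroup V] {f : α × β → V} (hf : StronglyMeasurable f) :
    Measurable fun t => eLpNorm (fun x => f (t, x)) ∞ ν := by
  refine measurable_of_Iic fun a => ?_
  have h : (fun t => eLpNorm (fun x => f (t, x)) ∞ ν) ⁻¹' Set.Iic a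
      = {t | ν (Prod.mk t ⁻¹' {z | a < ‖f z‖ₑ}) = 0} := by
    ext t
    have hset : (Prod.mk t ⁻¹' {z | a < ‖f z‖ₑ}) = {x | ¬ ‖f (t, x)‖ₑ ≤ a} := by
      ext x; simp
    rw [Set.mem_preimage, Set.mem_Iic, Set.mem_ofPred_eq, hset, ← ae_iff, eLpNorm_exponent_top]
    exact ⟨fun h => (ae_le_eLpNormEssSup).mono fun x hx => hx.trans h,
      eLpNormEssSup_le_of_ae_enorm_bound⟩
  rw [h]
  exact measurable_measure_prodMk_left (measurableSet_lt measurable_const hf.enorm)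
    (measurableSet_singleton 0)

lemma aemeasurable_eLpNorm_top_slice {α β V : Type*} [MeasurableSpace α] [MeasurableSpace β]
    {μ : Measure α} {ν : Measure β} [SFinite ν] [NormedAddCommGroup V] {f : α × β → V}
    (hf : AEStronglyMeasurable f (μ.prod ν)) :
    AEMeasurable (fun t => eLpNorm (fun x => f (t, x)) ∞ ν) μ :=
  ⟨_, measurable_eLpNorm_top_slice hf.stronglyMeasurable_mk,
    (ae_slice_ae_eq hf.ae_eq_mk).mono fun _ ht => eLpNorm_congr_ae ht⟩

lemma ae_eLpNorm_top_slice_le {α β V : Type*} [MeasurableSpace α] [MeasurableSpace β]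
    {μ : Measure α} {ν : Measure β} [SFinite ν] [NormedAddCommGroup V] (f : α × β → V) :
    ∀ᵐ t ∂μ, eLpNorm (fun x => f (t, x)) ∞ ν ≤ eLpNorm f ∞ (μ.prod ν) := by
  simp only [eLpNorm_exponent_top]
  exact (Measure.ae_ae_of_ae_prod (ae_le_eLpNormEssSup (f := f))).mono fun t ht =>
    eLpNormEssSup_le_of_ae_enorm_bound ht

/-- The bound holds for almost every `x` in each slice. Passing to almost every point of the product
needs a measurable set, hence the detour through a strongly measurable representative. -/
lemma ae_enorm_le_eLpNorm_top_slice {α β V : Type*} [MeasurableSpace α] [MeasurableSpace β]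
    {μ : Measure α} {ν : Measure β} [SFinite μ] [SFinite ν] [NormedAddCommGroup V] {f : α × β → V}
    (hf : AEStronglyMeasurable f (μ.prod ν)) :
    ∀ᵐ z ∂μ.prod ν, ‖f z‖ₑ ≤ eLpNorm (fun x => f (z.1, x)) ∞ ν := by
  have h1 : ∀ᵐ z ∂μ.prod ν, ‖hf.mk f z‖ₑ ≤ eLpNorm (fun x => hf.mk f (z.1, x)) ∞ ν := by
    refine (Measure.ae_prod_iff_ae_ae (measurableSet_le hf.stronglyMeasurable_mk.enorm
      ((measurable_eLpNorm_top_slice hf.stronglyMeasurable_mk).comp measurable_fst))).2 ?_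
    exact Eventually.of_forall fun t => by simpa using ae_le_eLpNormEssSup
  have h2 : ∀ᵐ z ∂μ.prod ν, (fun x => f (z.1, x)) =ᵐ[ν] fun x => hf.mk f (z.1, x) :=
    Measure.quasiMeasurePreserving_fst.ae (ae_slice_ae_eq hf.ae_eq_mk)
  filter_upwards [h1, h2, hf.ae_eq_mk] with z h1 h2 h3
  rw [h3, eLpNorm_congr_ae h2]
  exact h1

/-! ### Lower semicontinuity on a general measure space -/

section General

variable {α : Type*} [MeasurableSpace α] {μ : Measure α} {N : ℕ} {c κ : α → ℝ}
  {d u : α → Vec 3} {v : α → Vec N} {A : α → Mat3 N} {B M : ℝ}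

lemma memLp_gradU_bound (hu : MemLp u 2 μ) (hA : MemLp A 2 μ) (B M : ℝ) :
    MemLp (fun x => B * (2 * ‖u x‖ + M * ‖A x‖)) 2 μ :=
  ((hu.norm.const_mul 2).add (hA.norm.const_mul M)).const_mul B

lemma memLp_gradA_bound (hu : MemLp u 2 μ) (hA : MemLp A 2 μ) (B M : ℝ) :
    MemLp (fun x => B * (M * ‖A x‖ + M * ‖u x‖)) 2 μ :=
  ((hA.norm.const_mul M).add (hu.norm.const_mul M)).const_mul B

lemma memLp_gradU (hc : AEStronglyMeasurable c μ) (hcB : ∀ᵐ x ∂μ, |c x| ≤ B)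
    (hd : AEStronglyMeasurable d μ) (hd1 : ∀ᵐ x ∂μ, ‖d x‖ ≤ 1)
    (hv : AEStronglyMeasurable v μ) (hvM : ∀ᵐ x ∂μ, ‖v x‖ ≤ M)
    (hu : MemLp u 2 μ) (hA : MemLp A 2 μ) :
    MemLp (fun x => gradU (c x) (d x) (v x) (u x) (A x)) 2 μ := by
  refine (memLp_gradU_bound hu hA B M).mono' ?_ ?_
  · exact continuous_gradU.comp_aestronglyMeasurable
      (hc.prodMk (hd.prodMk (hv.prodMk (hu.1.prodMk hA.1))))
  · filter_upwards [hcB, hd1, hvM] with x h1 h2 h3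
    exact norm_gradU_le h1 h2 h3 _ _

lemma memLp_gradA (hc : AEStronglyMeasurable c μ) (hcB : ∀ᵐ x ∂μ, |c x| ≤ B)
    (hκ : AEStronglyMeasurable κ μ) (hκM : ∀ᵐ x ∂μ, |κ x| ≤ M)
    (hd : AEStronglyMeasurable d μ) (hd1 : ∀ᵐ x ∂μ, ‖d x‖ ≤ 1)
    (hv : AEStronglyMeasurable v μ) (hvM : ∀ᵐ x ∂μ, ‖v x‖ ≤ M)
    (hu : MemLp u 2 μ) (hA : MemLp A 2 μ) :
    MemLp (fun x => gradA (c x) (κ x) (d x) (v x) (u x) (A x)) 2 μ := by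
  refine (memLp_gradA_bound hu hA B M).mono' ?_ ?_
  · exact continuous_gradA.comp_aestronglyMeasurable
      (hc.prodMk (hκ.prodMk (hd.prodMk (hv.prodMk (hu.1.prodMk hA.1)))))
  · filter_upwards [hcB, hκM, hd1, hvM] with x h1 h2 h3 h4
    exact norm_gradA_le h1 h3 h4 h2 _ _

/-- By Euler's identity the form is half a sum of inner products of `L²` fields. No sign condition
enters. -/
lemma integrable_stressQuad (hc : AEStronglyMeasurable c μ) (hcB : ∀ᵐ x ∂μ, |c x| ≤ B)
    (hκ : AEStronglyMeasurable κ μ) (hκM : ∀ᵐ x ∂μ, |κ x| ≤ M)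
    (hd : AEStronglyMeasurable d μ) (hd1 : ∀ᵐ x ∂μ, ‖d x‖ ≤ 1)
    (hv : AEStronglyMeasurable v μ) (hvM : ∀ᵐ x ∂μ, ‖v x‖ ≤ M)
    (hu : MemLp u 2 μ) (hA : MemLp A 2 μ) :
    Integrable (fun x => stressQuad (c x) (κ x) (d x) (v x) (u x) (A x)) μ := by
  have h := ((integrable_inner_of_memLp (memLp_gradU hc hcB hd hd1 hv hvM hu hA) hu).add
    (integrable_inner_of_memLp (memLp_gradA hc hcB hκ hκM hd hd1 hv hvM hu hA) hA)).const_mul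
      (1 / 2)
  refine h.congr (Eventually.of_forall fun x => ?_)
  simp only [Pi.add_apply, inner_gradU_add_inner_gradA]
  ring

lemma weakL2Tendsto_const {V : Type*} [NormedAddCommGroup V] [NormedSpace ℝ V] {f : α → V}
    (hf : MemLp f 2 μ) : WeakL2Tendsto μ (fun _ => f) f :=
  ⟨fun _ => hf, hf, tendsto_const_nhds⟩

lemma integral_sub_add_sub {f g h k : α → ℝ} (hf : Integrable f μ) (hg : Integrable g μ)
    (hh : Integrable h μ) (hk : Integrable k μ) :
    ∫ x, (f x - g x + (h x - k x)) ∂μ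
      = (∫ x, f x ∂μ) - (∫ x, g x ∂μ) + ((∫ x, h x ∂μ) - ∫ x, k x ∂μ) := by
  rw [← integral_sub hf hg, ← integral_sub hh hk]
  exact integral_add (hf.sub hg) (hh.sub hk)

/-- The stress functional is sequentially lower semicontinuous along weakly `L²`-convergent
`u, A` and boundedly almost everywhere convergent coefficients. -/
theorem integral_stressQuad_le_liminf {κm : ℕ → α → ℝ} {dm um : ℕ → α → Vec 3}
    {vm : ℕ → α → Vec N} {Am : ℕ → α → Mat3 N}
    (hc : AEStronglyMeasurable c μ) (hcB : ∀ᵐ x ∂μ, |c x| ≤ B) (hc0 : ∀ᵐ x ∂μ, 0 ≤ c x)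
    (hκm : ∀ m, AEStronglyMeasurable (κm m) μ) (hκ : AEStronglyMeasurable κ μ)
    (hκmM : ∀ m, ∀ᵐ x ∂μ, |κm m x| ≤ M) (hκM : ∀ᵐ x ∂μ, |κ x| ≤ M)
    (hκlim : ∀ᵐ x ∂μ, Tendsto (fun m => κm m x) atTop (𝓝 (κ x)))
    (hdm : ∀ m, AEStronglyMeasurable (dm m) μ) (hd : AEStronglyMeasurable d μ)
    (hdm1 : ∀ m, ∀ᵐ x ∂μ, ‖dm m x‖ ≤ 1) (hd1 : ∀ᵐ x ∂μ, ‖d x‖ ≤ 1)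
    (hdlim : TendstoInMeasure μ dm atTop d)
    (hvm : ∀ m, AEStronglyMeasurable (vm m) μ) (hv : AEStronglyMeasurable v μ)
    (hvmM : ∀ m, ∀ᵐ x ∂μ, ‖vm m x‖ ≤ M) (hvM : ∀ᵐ x ∂μ, ‖v x‖ ≤ M)
    (hvlim : ∀ᵐ x ∂μ, Tendsto (fun m => vm m x) atTop (𝓝 (v x)))
    (hκv : ∀ m, ∀ᵐ x ∂μ, 1 / 2 * ‖vm m x‖ ^ 2 ≤ κm m x)
    (hu : WeakL2Tendsto μ um u) (hA : WeakL2Tendsto μ Am A) :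
    ((∫ x, stressQuad (c x) (κ x) (d x) (v x) (u x) (A x) ∂μ : ℝ) : EReal) ≤
      liminf (fun m => ((∫ x, stressQuad (c x) (κm m x) (dm m x) (vm m x) (um m x) (Am m x) ∂μ
        : ℝ) : EReal)) atTop := by
  obtain ⟨hum2, hu2, -⟩ := id hu
  obtain ⟨hAm2, hA2, -⟩ := id hA
  have hUm : ∀ m, MemLp (fun x => gradU (c x) (dm m x) (vm m x) (u x) (A x)) 2 μ := fun m =>
    memLp_gradU hc hcB (hdm m) (hdm1 m) (hvm m) (hvmM m) hu2 hA2
  have hU : MemLp (fun x => gradU (c x) (d x) (v x) (u x) (A x)) 2 μ :=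
    memLp_gradU hc hcB hd hd1 hv hvM hu2 hA2
  have hGm : ∀ m, MemLp (fun x => gradA (c x) (κm m x) (dm m x) (vm m x) (u x) (A x)) 2 μ :=
    fun m => memLp_gradA hc hcB (hκm m) (hκmM m) (hdm m) (hdm1 m) (hvm m) (hvmM m) hu2 hA2
  have hG : MemLp (fun x => gradA (c x) (κ x) (d x) (v x) (u x) (A x)) 2 μ :=
    memLp_gradA hc hcB hκ hκM hd hd1 hv hvM hu2 hA2
  -- Only `dm`, which converges in measure, forces the extraction of a subsequence.
  have hsub : ∀ ns : ℕ → ℕ, Tendsto ns atTop atTop → ∃ ms : ℕ → ℕ, Tendsto ms atTop atTop ∧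
      ∀ᵐ x ∂μ, Tendsto (fun k => (κm (ns (ms k)) x, dm (ns (ms k)) x, vm (ns (ms k)) x)) atTop
        (𝓝 (κ x, d x, v x)) := by
    intro ns hns
    obtain ⟨ms, hms, hae⟩ := (hdlim.comp hns).exists_seq_tendsto_ae
    refine ⟨ms, hms.tendsto_atTop, ?_⟩
    have ht := hns.comp hms.tendsto_atTop
    filter_upwards [hae, hκlim, hvlim] with x h1 h2 h3
    exact (h2.comp ht).prodMk_nhds (h1.prodMk_nhds (h3.comp ht))
  have sU : StrongLpTendsto 2 μ (fun m x => gradU (c x) (dm m x) (vm m x) (u x) (A x))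
      (fun x => gradU (c x) (d x) (v x) (u x) (A x)) := by
    refine strongLpTendsto_two_of_dominated hUm hU (memLp_gradU_bound hu2 hA2 B M)
      (Eventually.of_forall fun m => ?_) ?_ fun ns hns => ?_
    · filter_upwards [hcB, hdm1 m, hvmM m] with x h1 h2 h3 using norm_gradU_le h1 h2 h3 _ _
    · filter_upwards [hcB, hd1, hvM] with x h1 h2 h3 using norm_gradU_le h1 h2 h3 _ _
    · obtain ⟨ms, hms, hae⟩ := hsub ns hns
      refine ⟨ms, hms, hae.mono fun x hx => ?_⟩
      exact (continuous_gradU.tendsto (c x, d x, v x, u x, A x)).comp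
        (tendsto_const_nhds.prodMk_nhds (hx.snd_nhds.fst_nhds.prodMk_nhds
          (hx.snd_nhds.snd_nhds.prodMk_nhds tendsto_const_nhds)))
  have sG : StrongLpTendsto 2 μ (fun m x => gradA (c x) (κm m x) (dm m x) (vm m x) (u x) (A x))
      (fun x => gradA (c x) (κ x) (d x) (v x) (u x) (A x)) := by
    refine strongLpTendsto_two_of_dominated hGm hG (memLp_gradA_bound hu2 hA2 B M)
      (Eventually.of_forall fun m => ?_) ?_ fun ns hns => ?_
    · filter_upwards [hcB, hκmM m, hdm1 m, hvmM m] with x h1 h2 h3 h4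
        using norm_gradA_le h1 h3 h4 h2 _ _
    · filter_upwards [hcB, hκM, hd1, hvM] with x h1 h2 h3 h4 using norm_gradA_le h1 h3 h4 h2 _ _
    · obtain ⟨ms, hms, hae⟩ := hsub ns hns
      refine ⟨ms, hms, hae.mono fun x hx => ?_⟩
      exact (continuous_gradA.tendsto (c x, κ x, d x, v x, u x, A x)).comp
        (tendsto_const_nhds.prodMk_nhds (hx.fst_nhds.prodMk_nhds (hx.snd_nhds.fst_nhds.prodMk_nhds
          (hx.snd_nhds.snd_nhds.prodMk_nhds tendsto_const_nhds))))
  have hu2' : MemLp (fun x => (1 / 2 : ℝ) • u x) 2 μ := hu2.const_smul (1 / 2 : ℝ)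
  have hA2' : MemLp (fun x => (1 / 2 : ℝ) • A x) 2 μ := hA2.const_smul (1 / 2 : ℝ)
  -- The integrated tangent planes converge: strong slopes are tested against the weak sequences and
  -- against the fixed halves of the base point.
  have lim := ((hu.tendsto_integral_inner sU).sub
      ((weakL2Tendsto_const hu2').tendsto_integral_inner sU)).add
    ((hA.tendsto_integral_inner sG).sub ((weakL2Tendsto_const hA2').tendsto_integral_inner sG))
  have heq : ∫ x, stressQuad (c x) (κ x) (d x) (v x) (u x) (A x) ∂μ =
      (∫ x, inner ℝ (gradU (c x) (d x) (v x) (u x) (A x)) (u x) ∂μ)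
        - (∫ x, inner ℝ (gradU (c x) (d x) (v x) (u x) (A x)) ((1 / 2 : ℝ) • u x) ∂μ)
      + ((∫ x, inner ℝ (gradA (c x) (κ x) (d x) (v x) (u x) (A x)) (A x) ∂μ)
        - ∫ x, inner ℝ (gradA (c x) (κ x) (d x) (v x) (u x) (A x)) ((1 / 2 : ℝ) • A x) ∂μ) := by
    rw [← integral_sub_add_sub (integrable_inner_of_memLp hU hu2)
      (integrable_inner_of_memLp hU hu2') (integrable_inner_of_memLp hG hA2)
      (integrable_inner_of_memLp hG hA2')]
    refine integral_congr_ae (Eventually.of_forall fun x => ?_)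
    have := inner_gradU_add_inner_gradA (c x) (κ x) (d x) (v x) (u x) (A x)
    simp only [inner_smul_right]
    linarith
  rw [heq, ← (EReal.tendsto_coe.2 lim).liminf_eq]
  refine liminf_le_liminf (Eventually.of_forall fun m => EReal.coe_le_coe_iff.2 ?_)
  have i1 := integrable_inner_of_memLp (hUm m) (hum2 m)
  have i2 := integrable_inner_of_memLp (hUm m) hu2'
  have i3 := integrable_inner_of_memLp (hGm m) (hAm2 m)
  have i4 := integrable_inner_of_memLp (hGm m) hA2'
  rw [← integral_sub_add_sub i1 i2 i3 i4]
  refine integral_mono_ae ((i1.sub i2).add (i3.sub i4)) (integrable_stressQuad hc hcB (hκm m)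
    (hκmM m) (hdm m) (hdm1 m) (hvm m) (hvmM m) (hum2 m) (hAm2 m)) ?_
  filter_upwards [hc0, hdm1 m, hκv m] with x h1 h2 h3
  have := tangent_le_stressQuad h1 h2 h3 (u x) (um m x) (A x) (Am m x)
  simpa only [inner_sub_right] using this

end General

/-! ### Passage to the space-time cylinder -/

section Cylinder

variable {N : ℕ} {Ω : Set (Vec N)} {T : ℝ}

lemma ae_cylinder_fst {p : ℝ → Prop} (h : ∀ᵐ t ∂(volume.restrict (Set.Ioo 0 T)), p t) :
    ∀ᵐ z ∂(cylinder T Ω), p z.1 :=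
  Measure.quasiMeasurePreserving_fst.ae h

/-- The constant `K + K ^ 2` exceeds both `K` and `½K²`, so one `M` can bound the velocity and the
weight together. -/
lemma ae_abs_regWeight_le {v : ℝ × Vec N → Vec N} {K : ℝ}
    (hv : MemLp v ∞ (cylinder T Ω)) (hK : (eLpNorm v ∞ (cylinder T Ω)).toReal ≤ K) :
    ∀ᵐ z ∂(cylinder T Ω), |regWeight Ω (fun x => v (z.1, x))| ≤ K + K ^ 2 := by
  refine ae_cylinder_fst (p := fun t => |regWeight Ω (fun x => v (t, x))| ≤ K + K ^ 2)
    ((ae_eLpNorm_top_slice_le (ν := volume.restrict Ω) v).mono fun t ht => ?_)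
  have h1 := (ENNReal.toReal_mono hv.eLpNorm_ne_top ht).trans hK
  have h0 := ENNReal.toReal_nonneg (a := eLpNorm (fun x => v (t, x)) ∞ (volume.restrict Ω))
  rw [regWeight, abs_of_nonneg (by positivity)]
  nlinarith

lemma ae_norm_le_of_eLpNorm_top {α V : Type*} [MeasurableSpace α] {μ : Measure α}
    [NormedAddCommGroup V] {f : α → V} {K : ℝ} (hf : MemLp f ∞ μ)
    (hK : (eLpNorm f ∞ μ).toReal ≤ K) : ∀ᵐ x ∂μ, ‖f x‖ ≤ K := by
  have h := ae_le_eLpNormEssSup (f := f) (μ := μ)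
  rw [← eLpNorm_exponent_top] at h
  filter_upwards [h] with x hx
  have := ENNReal.toReal_mono hf.eLpNorm_ne_top hx
  rw [toReal_enorm] at this
  exact this.trans hK

lemma aestronglyMeasurable_regWeight {v : ℝ × Vec N → Vec N}
    (hv : AEStronglyMeasurable v (cylinder T Ω)) :
    AEStronglyMeasurable (fun z => regWeight Ω (fun x => v (z.1, x))) (cylinder T Ω) := by
  have h : AEMeasurable (fun t => regWeight Ω (fun x => v (t, x)))
      (volume.restrict (Set.Ioo 0 T)) :=
    (((aemeasurable_eLpNorm_top_slice hv).ennreal_toReal).pow_const 2).const_mul (1 / 2)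
  exact h.aestronglyMeasurable.comp_fst

lemma ae_half_sq_le_regWeight {v : ℝ × Vec N → Vec N} (hv : MemLp v ∞ (cylinder T Ω)) :
    ∀ᵐ z ∂(cylinder T Ω), 1 / 2 * ‖v z‖ ^ 2 ≤ regWeight Ω (fun x => v (z.1, x)) := by
  filter_upwards [ae_enorm_le_eLpNorm_top_slice hv.1,
    ae_cylinder_fst (Ω := Ω) (ae_eLpNorm_top_slice_le (ν := volume.restrict Ω) v)] with z h1 h2
  have := ENNReal.toReal_mono (h2.trans_lt hv.eLpNorm_lt_top).ne h1
  rw [toReal_enorm] at this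
  unfold regWeight
  gcongr

lemma ae_tendsto_of_tendsto_eLpNorm_top {α V : Type*} [MeasurableSpace α] {μ : Measure α}
    [NormedAddCommGroup V] {f : ℕ → α → V} {f₀ : α → V}
    (h : Tendsto (fun m => eLpNorm (f m - f₀) ∞ μ) atTop (𝓝 0)) :
    ∀ᵐ x ∂μ, Tendsto (fun m => f m x) atTop (𝓝 (f₀ x)) := by
  have hall : ∀ᵐ x ∂μ, ∀ m, ‖(f m - f₀) x‖ₑ ≤ eLpNorm (f m - f₀) ∞ μ :=
    ae_all_iff.2 fun m => ae_le_eLpNormEssSup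
  filter_upwards [hall] with x hx
  rw [tendsto_iff_edist_tendsto_0]
  refine tendsto_of_tendsto_of_tendsto_of_le_of_le tendsto_const_nhds h (fun _ => zero_le)
    fun m => ?_
  simpa [edist_eq_enorm_sub] using hx m

/-- For almost every `t` the slices converge in `L^∞(Ω)`, since their distance is at most the one on
the cylinder. The triangle inequality then squeezes their norms. -/
lemma ae_tendsto_regWeight {vm : ℕ → ℝ × Vec N → Vec N} {v : ℝ × Vec N → Vec N}
    (hv : StrongLpTendsto ∞ (cylinder T Ω) vm v) :
    ∀ᵐ z ∂(cylinder T Ω), Tendsto (fun m => regWeight Ω (fun x => vm m (z.1, x))) atTop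
      (𝓝 (regWeight Ω (fun x => v (z.1, x)))) := by
  obtain ⟨h1, h2, h3⟩ := hv
  have hall : ∀ᵐ t ∂(volume.restrict (Set.Ioo 0 T)), ∀ m,
      eLpNorm (fun x => (vm m - v) (t, x)) ∞ (volume.restrict Ω)
        ≤ eLpNorm (vm m - v) ∞ (cylinder T Ω) :=
    ae_all_iff.2 fun m => ae_eLpNorm_top_slice_le _
  refine ae_cylinder_fst (p := fun t => Tendsto (fun m => regWeight Ω (fun x => vm m (t, x))) atTop
    (𝓝 (regWeight Ω (fun x => v (t, x))))) ?_
  filter_upwards [hall, ae_eLpNorm_top_slice_le (μ := volume.restrict (Set.Ioo 0 T))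
    (ν := volume.restrict Ω) v] with t ht hvt
  have hfin : eLpNorm (fun x => v (t, x)) ∞ (volume.restrict Ω) ≠ ⊤ :=
    (hvt.trans_lt h2.eLpNorm_lt_top).ne
  have hz : Tendsto (fun m => eLpNorm (fun x => (vm m - v) (t, x)) ∞ (volume.restrict Ω)) atTop
      (𝓝 0) :=
    tendsto_of_tendsto_of_tendsto_of_le_of_le tendsto_const_nhds h3 (fun _ => zero_le) ht
  have hlim : Tendsto (fun m => eLpNorm (fun x => vm m (t, x)) ∞ (volume.restrict Ω)) atTop
      (𝓝 (eLpNorm (fun x => v (t, x)) ∞ (volume.restrict Ω))) := by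
    have hlo := ENNReal.Tendsto.sub (tendsto_const_nhds (x := eLpNorm (fun x => v (t, x)) ∞
      (volume.restrict Ω)) (f := atTop (α := ℕ))) hz (Or.inl hfin)
    have hup := (tendsto_const_nhds (x := eLpNorm (fun x => v (t, x)) ∞
      (volume.restrict Ω)) (f := atTop (α := ℕ))).add hz
    rw [tsub_zero] at hlo
    rw [add_zero] at hup
    refine tendsto_of_tendsto_of_tendsto_of_le_of_le hlo hup (fun m => ?_) fun m => ?_
    · refine tsub_le_iff_right.2 ?_
      have hneg : eLpNorm (fun x => (vm m - v) (t, x)) ∞ (volume.restrict Ω)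
          = eLpNorm (fun x => (v - vm m) (t, x)) ∞ (volume.restrict Ω) := by
        rw [← eLpNorm_neg]; congr 1; ext x : 1; simp
      rw [hneg]
      have := eLpNormEssSup_add_le (μ := volume.restrict Ω) (f := fun x => vm m (t, x))
        (g := fun x => (v - vm m) (t, x))
      refine le_trans (le_of_eq ?_) this
      rw [← eLpNorm_exponent_top]; congr 1; ext x : 1; simp
    · have := eLpNormEssSup_add_le (μ := volume.restrict Ω) (f := fun x => v (t, x))
        (g := fun x => (vm m - v) (t, x))
      refine le_trans (le_of_eq ?_) this
      rw [← eLpNorm_exponent_top]; congr 1; ext x : 1; simp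
  exact (((ENNReal.tendsto_toReal hfin).comp hlim).pow 2).const_mul (1 / 2)

/-- Fubini's theorem for the stress density. -/
lemma stressDensity_integrableOn_and_integral {φ : ℝ → ℝ} {d U : ℝ × Vec N → Vec 3}
    {G : ℝ × Vec N → Mat3 N} {v : ℝ × Vec N → Vec N}
    (hφ : MemLp φ ∞ (volume.restrict (Set.Ioo 0 T)))
    (hd : AEStronglyMeasurable d (cylinder T Ω)) (hd1 : ∀ᵐ z ∂(cylinder T Ω), ‖d z‖ ≤ 1)
    (hv : MemLp v ∞ (cylinder T Ω))
    (hU : MemLp U 2 (cylinder T Ω)) (hG : MemLp G 2 (cylinder T Ω)) :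
    IntegrableOn (stressDensity Ω φ d U G v) (Set.Ioo 0 T) ∧
      ∫ t in Set.Ioo 0 T, stressDensity Ω φ d U G v t =
        ∫ z, stressQuad (φ z.1) (regWeight Ω fun x => v (z.1, x)) (d z) (v z) (U z) (G z)
          ∂(cylinder T Ω) := by
  have hvK : ∀ᵐ z ∂(cylinder T Ω), ‖v z‖ ≤ (eLpNorm v ∞ (cylinder T Ω)).toReal
      + (eLpNorm v ∞ (cylinder T Ω)).toReal ^ 2 :=
    ae_norm_le_of_eLpNorm_top hv (le_add_of_nonneg_right (sq_nonneg _))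
  have hint : Integrable (fun z => stressQuad (φ z.1) (regWeight Ω fun x => v (z.1, x)) (d z) (v z)
      (U z) (G z)) (cylinder T Ω) :=
    integrable_stressQuad (B := (eLpNorm φ ∞ (volume.restrict (Set.Ioo 0 T))).toReal)
      hφ.1.comp_fst (ae_cylinder_fst (ae_norm_le_of_eLpNorm_top hφ le_rfl))
      (aestronglyMeasurable_regWeight hv.1) (ae_abs_regWeight_le hv le_rfl) hd hd1 hv.1 hvK hU hG
  -- With `c = 1` and `κ = 0` the form is `‖U‖²` minus the cross term, which isolates the
  -- integrability of the latter.
  have hint' : Integrable (fun z => stressQuad 1 0 (d z) (v z) (U z) (G z)) (cylinder T Ω) :=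
    integrable_stressQuad (B := 1) aestronglyMeasurable_const (by simp)
      aestronglyMeasurable_const (hvK.mono fun z hz => by
        simpa using (norm_nonneg _).trans hz) hd hd1 hv.1 hvK hU hG
  have hUi : Integrable (fun z => ‖U z‖ ^ 2) (cylinder T Ω) := hU.integrable_norm_pow two_ne_zero
  have hGi : Integrable (fun z => ‖G z‖ ^ 2) (cylinder T Ω) := hG.integrable_norm_pow two_ne_zero
  have hci : Integrable (fun z => transposeMulCross (G z) (d z) (U z) ⬝ᵥ (v z).ofLp)
      (cylinder T Ω) :=
    (hUi.sub hint').congr (Eventually.of_forall fun z => by simp [stressQuad])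
  have hslice : (fun t => ∫ x in Ω, stressQuad (φ t) (regWeight Ω fun x => v (t, x)) (d (t, x))
      (v (t, x)) (U (t, x)) (G (t, x))) =ᵐ[volume.restrict (Set.Ioo 0 T)]
        stressDensity Ω φ d U G v := by
    -- The slice integral splits into the three terms of `stressFunctional` only where each is
    -- integrable in `x`, which is almost every `t`.
    filter_upwards [hUi.prod_right_ae, hGi.prod_right_ae, hci.prod_right_ae] with t h1 h2 h3
    simp only [stressQuad, stressDensity, stressFunctional]
    have h4 := (h2.const_mul (1 / 2)).const_mul (regWeight Ω fun x => v (t, x))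
    have h5 := integral_sub_add_sub (k := fun _ => 0) h1 h3 h4 (integrable_zero _ _ _)
    simp only [sub_zero, integral_zero, integral_const_mul] at h5
    rw [integral_const_mul, h5]
  refine ⟨hint.integral_prod_left.congr hslice, ?_⟩
  rw [← integral_congr_ae hslice, cylinder, integral_prod _ hint]

end Cylinder

end EricksenStress

end

open EricksenStress in
theorem lemma4p4 (N : ℕ) (hN : N = 2 ∨ N = 3) (Ω : Set (EricksenStress.Vec N))
    (hΩ : EricksenStress.IsConvexPolyhedralDomain Ω) (T : ℝ) (hT : 0 < T)
    -- the sequences and their limits; `D` is the weak spatial gradient of `d`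
    (dm : ℕ → ℝ × EricksenStress.Vec N → EricksenStress.Vec 3)
    (d : ℝ × EricksenStress.Vec N → EricksenStress.Vec 3)
    (Gm : ℕ → ℝ × EricksenStress.Vec N → EricksenStress.Mat3 N)
    (D : ℝ × EricksenStress.Vec N → EricksenStress.Mat3 N)
    (Um : ℕ → ℝ × EricksenStress.Vec N → EricksenStress.Vec 3)
    (U : ℝ × EricksenStress.Vec N → EricksenStress.Vec 3)
    (vm : ℕ → ℝ × EricksenStress.Vec N → EricksenStress.Vec N)
    (v : ℝ × EricksenStress.Vec N → EricksenStress.Vec N)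
    (hD : ∀ᵐ t ∂(volume.restrict (Set.Ioo 0 T)),
      EricksenStress.HasWeakGradient Ω (fun x => d (t, x)) (fun x => D (t, x)))
    -- the convergences
    (hd : ∀ p : ℝ≥0∞, 1 ≤ p → p ≠ ⊤ →
      EricksenStress.StrongLpTendsto p (EricksenStress.cylinder T Ω) dm d)
    (hG : EricksenStress.WeakL2Tendsto (EricksenStress.cylinder T Ω) Gm D)
    (hU : EricksenStress.WeakL2Tendsto (EricksenStress.cylinder T Ω) Um U)
    (hv : EricksenStress.StrongLpTendsto ∞ (EricksenStress.cylinder T Ω) vm v)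
    -- the uniform bounds
    (hd_bound : ∀ m, eLpNorm (dm m) ∞ (EricksenStress.cylinder T Ω) ≤ 1)
    (C : ℝ) (hC : 0 < C)
    (hv_bound : ∀ m, ∀ᵐ t ∂(volume.restrict (Set.Ioo 0 T)),
      EricksenStress.H2NormLE Ω (fun x => vm m (t, x)) C) :
    ∀ φ : ℝ → ℝ, MemLp φ ∞ (volume.restrict (Set.Ioo 0 T)) →
      (∀ᵐ t ∂(volume.restrict (Set.Ioo 0 T)), 0 ≤ φ t) →
      IntegrableOn (EricksenStress.stressDensity Ω φ d U D v) (Set.Ioo 0 T) ∧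
      (∀ m, IntegrableOn
        (EricksenStress.stressDensity Ω φ (dm m) (Um m) (Gm m) (vm m)) (Set.Ioo 0 T)) ∧
      ((∫ t in Set.Ioo 0 T, EricksenStress.stressDensity Ω φ d U D v t : ℝ) : EReal) ≤
        liminf (fun m => ((∫ t in Set.Ioo 0 T,
          EricksenStress.stressDensity Ω φ (dm m) (Um m) (Gm m) (vm m) t : ℝ) : EReal)) atTop := by
  intro φ hφ hφ0
  obtain ⟨hvm, hvt, hvlim⟩ := id hv
  obtain ⟨hUm2, hU2, -⟩ := id hU
  obtain ⟨hGm2, hG2, -⟩ := id hG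
  obtain ⟨hdm2, hd2, hdlim⟩ := hd 2 one_le_two ENNReal.ofNat_ne_top
  have hdm1 : ∀ m, ∀ᵐ z ∂(cylinder T Ω), ‖dm m z‖ ≤ 1 := fun m =>
    ae_norm_le_of_eLpNorm_top ⟨(hdm2 m).1, (hd_bound m).trans_lt ENNReal.one_lt_top⟩
      (ENNReal.toReal_le_of_le_ofReal zero_le_one (by simpa using hd_bound m))
  have hdmeas : TendstoInMeasure (cylinder T Ω) dm atTop d :=
    tendstoInMeasure_of_tendsto_eLpNorm two_ne_zero (fun m => (hdm2 m).1) hd2.1 hdlim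
  -- The limit inherits the bound along an almost everywhere convergent subsequence.
  have hd1 : ∀ᵐ z ∂(cylinder T Ω), ‖d z‖ ≤ 1 := by
    obtain ⟨ns, -, hns⟩ := hdmeas.exists_seq_tendsto_ae
    filter_upwards [hns, ae_all_iff.2 hdm1] with z h1 h2
    exact le_of_tendsto h1.norm (Eventually.of_forall fun k => h2 (ns k))
  -- The uniform `L^∞` bound comes from the strong convergence: the norms of `vm m - v` tend to zero
  -- and so are bounded.
  obtain ⟨K, hK, hK0⟩ : ∃ K, (∀ m, (eLpNorm (vm m) ∞ (cylinder T Ω)).toReal ≤ K) ∧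
      (eLpNorm v ∞ (cylinder T Ω)).toReal ≤ K := by
    have h0 := (ENNReal.tendsto_toReal ENNReal.zero_ne_top).comp hvlim
    obtain ⟨b, hb⟩ := h0.bddAbove_range
    have hb' : ∀ m, (eLpNorm (vm m - v) ∞ (cylinder T Ω)).toReal ≤ b := fun m => hb ⟨m, rfl⟩
    refine ⟨b + (eLpNorm v ∞ (cylinder T Ω)).toReal, fun m => ?_,
      le_add_of_nonneg_left (ENNReal.toReal_nonneg.trans (hb' 0))⟩
    have h1 := eLpNorm_add_le ((hvm m).1.sub hvt.1) hvt.1 (p := ∞) le_top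
    rw [sub_add_cancel] at h1
    exact (ENNReal.toReal_le_add h1 ((hvm m).sub hvt).eLpNorm_ne_top hvt.eLpNorm_ne_top).trans
      (by gcongr; exact hb' m)
  have hKK : K ≤ K + K ^ 2 := le_add_of_nonneg_right (sq_nonneg _)
  have hlimit := stressDensity_integrableOn_and_integral hφ hd2.1 hd1 hvt hU2 hG2
  have hseq := fun m =>
    stressDensity_integrableOn_and_integral hφ (hdm2 m).1 (hdm1 m) (hvm m) (hUm2 m) (hGm2 m)
  refine ⟨hlimit.1, fun m => (hseq m).1, ?_⟩
  simp_rw [fun m => (hseq m).2]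
  rw [hlimit.2]
  exact integral_stressQuad_le_liminf
    (B := (eLpNorm φ ∞ (volume.restrict (Set.Ioo 0 T))).toReal) (M := K + K ^ 2)
    hφ.1.comp_fst (ae_cylinder_fst (ae_norm_le_of_eLpNorm_top hφ le_rfl)) (ae_cylinder_fst hφ0)
    (fun m => aestronglyMeasurable_regWeight (hvm m).1) (aestronglyMeasurable_regWeight hvt.1)
    (fun m => ae_abs_regWeight_le (hvm m) (hK m)) (ae_abs_regWeight_le hvt hK0)
    (ae_tendsto_regWeight hv) (fun m => (hdm2 m).1) hd2.1 hdm1 hd1 hdmeas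
    (fun m => (hvm m).1) hvt.1
    (fun m => ae_norm_le_of_eLpNorm_top (hvm m) ((hK m).trans hKK))
    (ae_norm_le_of_eLpNorm_top hvt (hK0.trans hKK))
    (ae_tendsto_of_tendsto_eLpNorm_top hvlim) (fun m => ae_half_sq_le_regWeight (hvm m)) hU hG
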